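/- Let $R$ be an arbitrary (unital, associative) ring, let $n\ge 0$, and let $\mathbb P^n(R)$ be the left projective space associated with the free left module $M=R^{n+1}$: a \emph{point} is a free rank-one submodule $A\subset M$ that is a direct summand of $M$, and a \emph{hyperplane} is a submodule $\ell\subset M$ such that $M=A\oplus\ell$ for some point $A$. A point $A$ and a hyperplane $\ell$ are \emph{non-neighboring} if $M=A\oplus \ell$. Points $A_1,A_2$ and hyperplanes $\ell_1,\ell_2$ such that each $A_i$ is non-neighboring to each $\ell_j$ are \emph{coherent} if $(A_1+A_2)\cap \ell_1=(A_1+A_2)\cap \ell_2$. A \emph{tiling} $\mathcal T$ of a closed, connected, orientable surface is a finite cellular decomposition (given combinatorially, as an orientation-reversing gluing in pairs of the sides of finitely many oriented polygons) in which the closure of every face is an embedded quadrilateral (a \emph{tile}), together with a colouring of the vertices in black and white such that every edge joins vertices of different colours. The genus $g$ of the surface is given by $V-E+F=2-2g$, where $V$, $E$, $F$ are the numbers of vertices, edges and faces. The tiling is \emph{simple} if no two edges are incident to the same pair of vertices. Let $B(\mathcal T)$ be the set of black vertices. A \emph{realization} of $\mathcal T$ in $\mathbb P^n(R)$ assigns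 a point to each black vertex and a hyperplane to each white vertex so that, for every edge, the point and the hyperplane assigned to its endpoints are non-neighboring. A tile is \emph{coherent} if the two points and two hyperplanes assigned to its vertices are coherent. The \emph{incidence theorem corresponding to $\mathcal T$ in $\mathbb P^n(R)$} is the statement: in every realization of $\mathcal T$ in $\mathbb P^n(R)$, if all tiles except one are coherent, then the remaining tile is also coherent. \textbf{Theorem.} Let $\mathcal T$ be a simple tiling of a closed, connected, orientable surface of genus $g>0$, let $R$ be a ring, and suppose that $n\ge |B(\mathcal T)|-1$. Then the incidence theorem corresponding to $\mathcal T$ holds in $\mathbb P^n(R)$ if and only if the group of units $R^\times$ is commutative. -/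

import Mathlib

universe u v w

/-! ### Cellular decompositions of closed oriented surfaces -/

/-- A cellular decomposition of a closed, connected, oriented surface, given as a combinatorial map.
The surface is obtained from finitely many oriented polygons by gluing their sides in pairs,
reversing orientation.  A dart is a side of a polygon, traversed in the positive direction of its
boundary; equivalently, it is an oriented edge of the decomposition, the polygon being the one on
its left.  `next` sends a dart to the following one along the boundary of its polygon, `rev`
sends a dart to the one it is glued to, i.e. to the same edge with the opposite orientation. -/
structure SurfaceMap where
  /-- the oriented edges -/
  Dart : Type u
  [fintypeDart : Fintype Dart]
  [nonemptyDart : Nonempty Dart]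
  /-- the next oriented edge on the boundary of the face on the left -/
  next : Equiv.Perm Dart
  /-- orientation reversal -/
  rev : Equiv.Perm Dart
  rev_rev : ∀ d, rev (rev d) = d
  rev_ne : ∀ d, rev d ≠ d
  /-- the surface is connected -/
  connected : ∀ d d', ∃ g ∈ Subgroup.closure {next, rev}, g d = d'

namespace SurfaceMap

variable (S : SurfaceMap.{u})

/-- Rotation about the tail: `rev d` ends at the tail of `d`, so `next (rev d)` starts there. -/
def rot : Equiv.Perm S.Dart := S.next * S.rev

/-- The vertices are the cycles of the rotation (a cycle is the set of oriented edges leaving the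
vertex, in cyclic order). -/
def Vertex : Type u := Quotient (Equiv.Perm.SameCycle.setoid S.rot)

/-- The (unoriented) edges are the cycles of orientation reversal. -/
def Edge : Type u := Quotient (Equiv.Perm.SameCycle.setoid S.rev)

/-- The faces are the cycles of `next`. -/
def Face : Type u := Quotient (Equiv.Perm.SameCycle.setoid S.next)

variable {S}

/-- The tail of an oriented edge. -/
def tail (d : S.Dart) : S.Vertex := Quotient.mk (Equiv.Perm.SameCycle.setoid S.rot) d

/-- The head of an oriented edge. -/
def head (d : S.Dart) : S.Vertex := tail (S.rev d)

/-- The underlying edge of an oriented edge. -/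
def edge (d : S.Dart) : S.Edge := Quotient.mk (Equiv.Perm.SameCycle.setoid S.rev) d

/-- The face on the left of an oriented edge. -/
def face (d : S.Dart) : S.Face := Quotient.mk (Equiv.Perm.SameCycle.setoid S.next) d

variable (S)

/-- The Euler characteristic `V - E + F`. -/
noncomputable def eulerChar : ℤ :=
  (Nat.card S.Vertex : ℤ) - (Nat.card S.Edge : ℤ) + (Nat.card S.Face : ℤ)

/-- The closed oriented surface underlying `S` has genus `g`: `V - E + F = 2 - 2 g`. -/
def HasGenus (g : ℕ) : Prop := S.eulerChar = 2 - 2 * (g : ℤ)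

end SurfaceMap

/-! ### Quadrilateral tilings -/

/-- A quadrilateral tiling of a closed, connected, oriented surface: a cellular decomposition in
which the closure of every face is an embedded quadrilateral, with vertices coloured black and white
so that every edge joins vertices of different colours. -/
structure Tiling extends SurfaceMap.{u} where
  /-- every face is a quadrilateral -/
  next_four : ∀ d, next (next (next (next d))) = d
  /-- every face is embedded: its four corners are pairwise distinct -/
  embedded : ∀ d, Function.Injective
    ![SurfaceMap.tail d, SurfaceMap.tail (next d), SurfaceMap.tail (next (next d)),
      SurfaceMap.tail (next (next (next d)))]
  /-- the set of black vertices; the remaining ones are white -/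
  black : Set toSurfaceMap.Vertex
  /-- every edge joins vertices of different colours -/
  bipartite : ∀ d : Dart, SurfaceMap.head d ∈ black ↔ SurfaceMap.tail d ∉ black

namespace Tiling

variable (T : Tiling.{u})

/-- `B(T)`. -/
def BlackVertex : Type u := {x : T.Vertex // x ∈ T.black}

/-- `W(T)`. -/
def WhiteVertex : Type u := {x : T.Vertex // x ∉ T.black}

/-- No two edges are incident to the same pair of vertices. -/
def IsSimple : Prop :=
  ∀ d d' : T.Dart,
    s(SurfaceMap.tail d, SurfaceMap.head d) = s(SurfaceMap.tail d', SurfaceMap.head d') →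
      SurfaceMap.edge d = SurfaceMap.edge d'

variable {T}

/-- Some edge of the tiling joins `x` and `y`. -/
def Adj (x y : T.Vertex) : Prop :=
  ∃ d : T.Dart, s(SurfaceMap.tail d, SurfaceMap.head d) = s(x, y)

/-- `x` is a vertex of the tile `f`. -/
def IsCorner (f : T.Face) (x : T.Vertex) : Prop :=
  ∃ d : T.Dart, SurfaceMap.face d = f ∧ SurfaceMap.tail d = x

end Tiling

/-! ### Projective geometry over a ring -/

namespace RingProj

variable {R : Type v} [Ring R] {M : Type w} [AddCommGroup M] [Module R M]

/-- A point of `ℙ(M)`: a free rank-one submodule that is a direct summand of `M`. -/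
def IsPoint (A : Submodule R M) : Prop :=
  Nonempty (A ≃ₗ[R] R) ∧ ∃ l : Submodule R M, IsCompl A l

/-- A hyperplane of `ℙ(M)`: a complement of a point. -/
def IsHyperplane (l : Submodule R M) : Prop :=
  ∃ A : Submodule R M, IsPoint A ∧ IsCompl A l

/-- A point `A` and a hyperplane `l` are non-neighbouring if `M = A ⊕ l`. -/
def NonNeighboring (A l : Submodule R M) : Prop := IsCompl A l

/-- Coherence of two points and two hyperplanes. -/
def Coherent (A₁ A₂ l₁ l₂ : Submodule R M) : Prop :=
  (A₁ ⊔ A₂) ⊓ l₁ = (A₁ ⊔ A₂) ⊓ l₂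

end RingProj

/-! ### The incidence theorem of a tiling -/

namespace Tiling

/-- A realization of the tiling `T` in `ℙ(M)`. -/
structure Realization (T : Tiling.{u}) (R : Type v) [Ring R] (M : Type w) [AddCommGroup M]
    [Module R M] where
  /-- the point assigned to a black vertex -/
  point : T.BlackVertex → Submodule R M
  /-- the hyperplane assigned to a white vertex -/
  hyperplane : T.WhiteVertex → Submodule R M
  isPoint : ∀ b, RingProj.IsPoint (point b)
  isHyperplane : ∀ y, RingProj.IsHyperplane (hyperplane y)
  nonNeighboring : ∀ b y, Adj b.1 y.1 → RingProj.NonNeighboring (point b) (hyperplane y)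

/-- A tile is coherent in a realization if the points assigned to its two black vertices and the
hyperplanes assigned to its two white vertices form a coherent quadruple. -/
def Realization.TileCoherent {T : Tiling.{u}} {R : Type v} [Ring R] {M : Type w} [AddCommGroup M]
    [Module R M] (ρ : T.Realization R M) (f : T.Face) : Prop :=
  ∀ (b₁ b₂ : T.BlackVertex) (y₁ y₂ : T.WhiteVertex), b₁ ≠ b₂ → y₁ ≠ y₂ →
    IsCorner f b₁.1 → IsCorner f b₂.1 → IsCorner f y₁.1 → IsCorner f y₂.1 →
      RingProj.Coherent (ρ.point b₁) (ρ.point b₂) (ρ.hyperplane y₁) (ρ.hyperplane y₂)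

/-- The incidence theorem associated with `T` in the left projective space `ℙⁿ(R)`, that is in
`ℙ(M)` for `M` the free left `R`-module of rank `n + 1`: in every realization, if all tiles except
one are coherent, then the remaining tile is also coherent. -/
def IncidenceTheorem (T : Tiling.{u}) (n : ℕ) (R : Type v) [Ring R] : Prop :=
  ∀ (ρ : T.Realization R (Fin (n + 1) → R)) (f₀ : T.Face),
    (∀ f, f ≠ f₀ → ρ.TileCoherent f) → ρ.TileCoherent f₀

end Tiling

/-! ### Cycles of a permutation multiplied by a transposition -/

namespace Equiv.Perm

variable {D : Type*}

/-! Write points as spans of vectors `a_b` and hyperplanes as kernels of functionals `f_y`. On edges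
the values `f_y a_b` are units, so they form a cochain `u : Dart → Rˣ` with `u (rev d) = (u d)⁻¹`,
and a tile is coherent iff the holonomy of `u` round it is trivial (`coherent_iff`,
`tileCoherent_iff`). If `Rˣ` is commutative, the product of all the holonomies is the product of `u`
over all darts, where edges cancel; so one holonomy is determined by the others.

Conversely, on a simple tiling with the black vertices at distinct basis vectors, every cochain
arises from a realization (`exists_realization`). It remains to find, from noncommuting units and
genus `g > 0`, a cochain with exactly one nontrivial holonomy. Regard the faces as discs and a set
of edges, encoded by a part `β` of `rev`, as ribbons joining them: the cycles of `next * β` are the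
boundary components. A new ribbon merges two components or splits one. If edges could always be
added so that, after a merging stage, each one splits, then `V - E + F ≥ 2`. For `g > 0` some edge
therefore has its two sides on one component for `β` but on different ones for a larger `β'`.
Potentials constant on components then yield the cochain, with a commutator as its only obstruction.
-/

theorem SameCycle.eq_of_invariant {β : Type*} {f : Perm D} {p : D → β} (hp : ∀ x, p (f x) = p x)
    {x y : D} (h : f.SameCycle x y) : p x = p y := by
  obtain ⟨i, rfl⟩ := h
  induction i with
  | zero => simp
  | succ n ih => rw [ih, add_comm, zpow_add, zpow_one, mul_apply, hp]
  | pred n ih =>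
    rw [ih, ← hp ((f ^ (-(n : ℤ) - 1)) x), ← mul_apply, ← zpow_one_add]
    congr 3
    ring

theorem sameCycle_apply_self (f : Perm D) (x : D) : f.SameCycle x (f x) := ⟨1, by simp⟩

/-- The number of cycles of a permutation, fixed points included. -/
noncomputable def numCycles (f : Perm D) : ℕ := Nat.card (Quotient (SameCycle.setoid f))

theorem numCycles_pos [Finite D] [Nonempty D] (f : Perm D) : 0 < numCycles f := by
  have : Nonempty (Quotient (SameCycle.setoid f)) := ⟨Quotient.mk _ (Classical.arbitrary D)⟩
  exact Nat.card_pos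

variable [DecidableEq D] [Finite D]

/-- The new permutation sends `x` to `f y` and then follows the `f`-orbit of `y`, which avoids `x`,
until it returns to `y`. -/
theorem SameCycle.mul_swap_of_not {f : Perm D} {x y : D} (h : ¬ f.SameCycle x y) :
    (f * swap x y).SameCycle x y := by
  by_contra hc
  have key : ∀ n : ℕ, ¬ (f * swap x y).SameCycle y ((f ^ (n + 1)) y) := by
    intro n
    induction n with
    | zero =>
      intro h1
      have h2 := sameCycle_apply_self (f * swap x y) x
      rw [mul_apply, swap_apply_left] at h2
      rw [zero_add, pow_one] at h1
      exact hc (h2.trans h1.symm)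
    | succ n ih =>
      rw [pow_succ', mul_apply]
      set d := (f ^ (n + 1)) y with hd
      have hdy : f.SameCycle y d := ⟨((n + 1 : ℕ) : ℤ), by rw [zpow_natCast]⟩
      have hdx : d ≠ x := fun e => h (e ▸ hdy).symm
      have hdne : d ≠ y := fun e => ih (e ▸ SameCycle.refl _ _)
      intro h1
      have h2 := sameCycle_apply_self (f * swap x y) d
      rw [mul_apply, swap_apply_of_ne_of_ne hdx hdne] at h2
      exact ih (h1.trans h2.symm)
  obtain ⟨k, hk, hfk⟩ := (isOfFinOrder_of_finite f).exists_pow_eq_one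
  refine key (k - 1) ?_
  rw [Nat.sub_add_cancel hk, hfk]
  exact SameCycle.refl _ _

/-- With `k` least such that `f ^ k` sends `x` to `y`, the set `f x, ..., f ^ k x = y` is closed
under the new permutation, which sends `y` back to `f x`; it does not contain `x`. -/
theorem SameCycle.not_mul_swap {f : Perm D} {x y : D} (hne : x ≠ y) (h : f.SameCycle x y) :
    ¬ (f * swap x y).SameCycle x y := by
  classical
  have hex : ∃ k : ℕ, (f ^ k) x = y := by
    obtain ⟨k, -, hk⟩ := h.exists_pow_eq'
    exact ⟨k, hk⟩
  set k := Nat.find hex with hkdef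
  have hk : (f ^ k) x = y := Nat.find_spec hex
  have hmin : ∀ m < k, (f ^ m) x ≠ y := fun m hm => Nat.find_min hex hm
  have hret : ∀ i, 0 < i → i ≤ k → (f ^ i) x ≠ x := by
    intro i hi hik e
    refine hmin (k - i) (by omega) ?_
    conv_lhs => rw [← e]
    rw [← mul_apply, ← pow_add, Nat.sub_add_cancel hik, hk]
  have hk0 : 0 < k := by
    rcases Nat.eq_zero_or_pos k with h0 | h0
    · rw [h0] at hk
      exact absurd hk (by simpa using hne)
    · exact h0
  let S : D → Prop := fun d => ∃ i, 0 < i ∧ i ≤ k ∧ (f ^ i) x = d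
  have hS : ∀ d, S d → S ((f * swap x y) d) := by
    rintro d ⟨i, hi, hik, rfl⟩
    rw [mul_apply]
    rcases hik.eq_or_lt with rfl | hlt
    · rw [hk, swap_apply_right]
      exact ⟨1, one_pos, hk0, by simp⟩
    · rw [swap_apply_of_ne_of_ne (hret i hi hik) (hmin i hlt)]
      exact ⟨i + 1, by omega, hlt, by rw [pow_succ', mul_apply]⟩
  intro hc
  obtain ⟨j, -, hj⟩ := hc.symm.exists_pow_eq'
  have hpow : ∀ m : ℕ, S (((f * swap x y) ^ m) y) := by
    intro m
    induction m with
    | zero => exact ⟨k, hk0, le_rfl, by simpa using hk⟩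
    | succ m ih =>
      rw [pow_succ', mul_apply]
      exact hS _ ih
  obtain ⟨i, hi, hik, e⟩ := hj ▸ hpow j
  exact hret i hi hik e

/-- The new cycles refine the old ones; equality of the counts would make the refinement map
injective, although it identifies the distinct cycles of `x` and `y`. -/
theorem SameCycle.numCycles_lt_mul_swap {f : Perm D} {x y : D} (hne : x ≠ y)
    (h : f.SameCycle x y) : numCycles f < numCycles (f * swap x y) := by
  have hinv : ∀ d, (Quotient.mk (SameCycle.setoid f) ((f * swap x y) d)) = Quotient.mk _ d := by
    intro d
    have h1 : f.SameCycle (swap x y d) d := by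
      rcases eq_or_ne d x with rfl | h1
      · rw [swap_apply_left]; exact h.symm
      rcases eq_or_ne d y with rfl | h2
      · rw [swap_apply_right]; exact h
      rw [swap_apply_of_ne_of_ne h1 h2]
    exact Quotient.sound ((sameCycle_apply_self f _).symm.trans h1)
  let g : Quotient (SameCycle.setoid (f * swap x y)) → Quotient (SameCycle.setoid f) :=
    Quotient.lift (fun d => Quotient.mk _ d)
      fun _ _ hab => SameCycle.eq_of_invariant (f := f * swap x y) hinv hab
  have hg : Function.Surjective g := fun c => by
    obtain ⟨d, rfl⟩ := Quotient.exists_rep c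
    exact ⟨Quotient.mk _ d, Eq.refl _⟩
  refine lt_of_le_of_ne (Nat.card_le_card_of_surjective g hg) fun hcard => ?_
  have hb := (Nat.bijective_iff_surjective_and_card g).2 ⟨hg, hcard.symm⟩
  have e : g (Quotient.mk _ x) = g (Quotient.mk _ y) := Quotient.sound h
  exact h.not_mul_swap hne (Quotient.exact (hb.1 e))

theorem numCycles_mul_swap_lt {f : Perm D} {x y : D} (h : ¬ f.SameCycle x y) :
    numCycles (f * swap x y) < numCycles f := by
  have hne : x ≠ y := fun e => h (e ▸ SameCycle.refl _ _)
  have h1 := (SameCycle.mul_swap_of_not h).numCycles_lt_mul_swap hne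
  rwa [mul_assoc, swap_mul_self, mul_one] at h1

end Equiv.Perm

/-! ### Partial involutions as ribbon subgraphs, and the Euler inequality -/

namespace Equiv.Perm

variable {D : Type*}

/-- `β` agrees with `α` on a set of points and fixes the others. -/
def IsPartOf (β α : Perm D) : Prop := ∀ d, β d = d ∨ β d = α d

/-- `β'` agrees with `α` wherever `β` does. -/
def Extends (α β β' : Perm D) : Prop := ∀ d, β d = α d → β' d = α d

namespace IsPartOf

variable {α β : Perm D} (hα : ∀ d, α (α d) = d)

include hα

theorem apply_apply_eq (h : β.IsPartOf α) {d : D} (hd : β d = α d) : β (α d) = d := by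
  rcases h (α d) with h1 | h1
  · rw [h1]
    exact β.injective (h1.trans hd.symm)
  · rw [h1, hα]

theorem apply_apply (h : β.IsPartOf α) (d : D) : β (β d) = d := by
  rcases h d with h1 | h1
  · rw [h1, h1]
  · rw [h1, h.apply_apply_eq hα h1]

theorem apply_eq_of_fixed (h : β.IsPartOf α) {d : D} (hd : β d = d) : β (α d) = α d := by
  rcases h (α d) with h1 | h1
  · exact h1
  · rw [hα] at h1
    have := β.injective (h1.trans hd.symm)
    rw [this, hd]

variable [DecidableEq D]

theorem mul_swap (h : β.IsPartOf α) {y : D} (hy : β y = y) :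
    (β * swap y (α y)).IsPartOf α := by
  intro d
  rw [mul_apply]
  rcases eq_or_ne d y with rfl | h1
  · rw [swap_apply_left]
    exact Or.inr (h.apply_eq_of_fixed hα hy)
  rcases eq_or_ne d (α y) with rfl | h2
  · rw [swap_apply_right, hα]
    exact Or.inr hy
  rw [swap_apply_of_ne_of_ne h1 h2]
  exact h d

theorem extends_mul_swap (h : β.IsPartOf α) (hne : ∀ d, α d ≠ d) {y : D} (hy : β y = y) :
    Extends α β (β * swap y (α y)) := by
  intro d hd
  have h1 : d ≠ y := by rintro rfl; exact hne d (hd.symm.trans hy)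
  have h2 : d ≠ α y := by
    rintro rfl
    exact hne _ (hd.symm.trans (h.apply_eq_of_fixed hα hy))
  rw [mul_apply, swap_apply_of_ne_of_ne h1 h2, hd]

theorem card_support_mul_swap [Fintype D] (h : β.IsPartOf α) (hne : ∀ d, α d ≠ d) {y : D}
    (hy : β y = y) : (β * swap y (α y)).support.card = β.support.card + 2 := by
  rw [Disjoint.card_support_mul, card_support_swap (hne y).symm]
  intro d
  rcases eq_or_ne d y with rfl | h1
  · exact Or.inl hy
  rcases eq_or_ne d (α y) with rfl | h2
  · exact Or.inl (h.apply_eq_of_fixed hα hy)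
  · exact Or.inr (swap_apply_of_ne_of_ne h1 h2)

end IsPartOf

/-- If multiplying `φ` by more and more transpositions of the involution `α` never reunites a
cycle which has been split, then `φ`, `α` and `φ * α` satisfy the planar Euler inequality. -/
theorem card_add_two_mul_numCycles_le [DecidableEq D] [Fintype D] (φ α : Perm D)
    (hα : ∀ d, α (α d) = d) (hne : ∀ d, α d ≠ d)
    (hsplit : ∀ β β' : Perm D, β.IsPartOf α → β'.IsPartOf α → Extends α β β' →
      ∀ y, β' y = y → (φ * β).SameCycle y (α y) → (φ * β').SameCycle y (α y)) :
    ∃ β : Perm D, Fintype.card D + 4 * numCycles (φ * β) ≤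
      2 * numCycles φ + 2 * numCycles (φ * α) := by
  classical
  -- Merging stage: each edge adds 2 to the support and must lower the number of cycles by at least
  -- 1. At a maximal `β` no remaining edge joins different cycles.
  let A : Finset (Perm D) := Finset.univ.filter fun β =>
    β.IsPartOf α ∧ 2 * numCycles (φ * β) + β.support.card ≤ 2 * numCycles φ
  have hA : A.Nonempty := ⟨1, Finset.mem_filter.2 ⟨Finset.mem_univ _, fun _ => Or.inl rfl, by simp⟩⟩
  obtain ⟨β, hβA, hβmax⟩ := A.exists_max_image (fun β => β.support.card) hA
  obtain ⟨hβ, hβc⟩ := (Finset.mem_filter.1 hβA).2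
  have hβsame : ∀ y, β y = y → (φ * β).SameCycle y (α y) := by
    intro y hy
    by_contra hc
    have h1 := numCycles_mul_swap_lt hc
    rw [mul_assoc] at h1
    have h2 := hβ.card_support_mul_swap hα hne hy
    have h3 := hβmax (β * swap y (α y)) (Finset.mem_filter.2
      ⟨Finset.mem_univ _, hβ.mul_swap hα hy, by omega⟩)
    omega
  -- Splitting stage above `β`: each further edge must raise the number of cycles by at least 1. By
  -- `hsplit` this never gets stuck, so a maximal `β'` is all of `α`.
  let B : Finset (Perm D) := Finset.univ.filter fun β' =>
    β'.IsPartOf α ∧ Extends α β β' ∧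
      2 * numCycles (φ * β) + β'.support.card ≤ 2 * numCycles (φ * β') + β.support.card
  have hB : B.Nonempty := ⟨β, Finset.mem_filter.2 ⟨Finset.mem_univ _, hβ, fun _ h => h, le_rfl⟩⟩
  obtain ⟨β', hB', hmax⟩ := B.exists_max_image (fun β => β.support.card) hB
  obtain ⟨hβ', hext, hc'⟩ := (Finset.mem_filter.1 hB').2
  have hfull : ∀ y, β' y ≠ y := by
    intro y hy
    have hβy : β y = y := (hβ y).resolve_right fun h => hne y ((hext y h).symm.trans hy)
    have hs := hsplit β β' hβ hβ' hext y hy (hβsame y hβy)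
    have h1 := hs.numCycles_lt_mul_swap (hne y).symm
    rw [mul_assoc] at h1
    have h2 := hβ'.card_support_mul_swap hα hne hy
    have h3 := hmax (β' * swap y (α y)) (Finset.mem_filter.2
      ⟨Finset.mem_univ _, hβ'.mul_swap hα hy,
        fun d hd => hβ'.extends_mul_swap hα hne hy d (hext d hd), by omega⟩)
    omega
  have hβα : β' = α := Equiv.ext fun d => (hβ' d).resolve_left (hfull d)
  have hsupp : β'.support.card = Fintype.card D := by
    rw [← Finset.card_univ]
    congr 1
    ext d
    simp [hfull d]
  rw [hβα] at hsupp hc'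
  exact ⟨β, by omega⟩

/-- Two noncommuting elements `a`, `b` of a group give a cochain whose holonomy round the cycles
of `φ` vanishes, except round the cycle of `y`. -/
theorem exists_cochain [DecidableEq D] [Finite D] {G : Type*} [Group G] {a b : G}
    (hab : a * b ≠ b * a)
    (φ α : Perm D) (hα : ∀ d, α (α d) = d) (hne : ∀ d, α d ≠ d) {β β' : Perm D}
    (hβ : β.IsPartOf α) (hβ' : β'.IsPartOf α) (hext : Extends α β β') {y : D} (hy : β' y = y)
    (h1 : (φ * β).SameCycle y (α y)) (h2 : ¬ (φ * β').SameCycle y (α y)) :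
    ∃ u h : D → G, (∀ d, u (α d) = (u d)⁻¹) ∧ (∀ d, d ≠ y → h (φ d) = h d * u d) ∧
      h (φ y) ≠ h y * u y := by
  classical
  have hβy : β y = y := (hβ y).resolve_right fun h => hne y ((hext y h).symm.trans hy)
  have hβαy := hβ.apply_eq_of_fixed hα hβy
  have hβ'αy := hβ'.apply_eq_of_fixed hα hy
  let s := swap y (α y)
  -- `p` is constant on the cycles of `φ * β'` and `q` on those of `φ * β * s`. Each separates `y`
  -- from `α y`: `p` by `h2`, `q` because the transposition splits the common cycle given by `h1`.
  let p : D → G := fun d => if (φ * β').SameCycle y d then a else 1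
  let q : D → G := fun d => if (φ * β * s).SameCycle y d then b⁻¹ else 1
  have hp : ∀ d, p (φ d) = p (β' d) := by
    intro d
    have e : (φ * β').SameCycle (β' d) (φ d) :=
      ⟨1, by rw [zpow_one, mul_apply, hβ'.apply_apply hα]⟩
    have : (φ * β').SameCycle y (φ d) ↔ (φ * β').SameCycle y (β' d) :=
      ⟨fun h => h.trans e.symm, fun h => h.trans e⟩
    simp only [p, this]
  have hq : ∀ d, q (φ d) = q (s (β d)) := by
    intro d
    have e : (φ * β * s).SameCycle (s (β d)) (φ d) :=
      ⟨1, by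
        rw [zpow_one, mul_apply, mul_apply, swap_apply_self, hβ.apply_apply hα]⟩
    have : (φ * β * s).SameCycle y (φ d) ↔ (φ * β * s).SameCycle y (s (β d)) :=
      ⟨fun h => h.trans e.symm, fun h => h.trans e⟩
    simp only [q, this]
  have hpy : p y = a := if_pos (SameCycle.refl _ _)
  have hpαy : p (α y) = 1 := if_neg h2
  have hqy : q y = b⁻¹ := if_pos (SameCycle.refl _ _)
  have hqαy : q (α y) = 1 := if_neg (h1.not_mul_swap (hne y).symm)
  have hs : ∀ d, d ≠ y → d ≠ α y → s d = d := fun d => swap_apply_of_ne_of_ne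
  let h : D → G := fun d => q d * p d
  -- The values are forced by `h (φ d) = h d * u d`, using `p (φ d) = p (β' d)` and `q (φ d) = q (s
  -- (β d))`. Only on the edge of `y` is there a conflict; the value there is chosen to suit `α y`.
  let u : D → G := fun d =>
    if d = y then b else if d = α y then b⁻¹ else
      if β d = d then (p d)⁻¹ * p (β' d) else (h d)⁻¹ * h (β d)
  have huy : u y = b := if_pos rfl
  have huαy : u (α y) = b⁻¹ := by
    change (if α y = y then b else if α y = α y then b⁻¹ else _) = _
    rw [if_neg (hne y), if_pos rfl]
  have hu : ∀ d, d ≠ y → d ≠ α y → u d =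
      if β d = d then (p d)⁻¹ * p (β' d) else (h d)⁻¹ * h (β d) := by
    intro d hd hd'
    simp only [u]
    rw [if_neg hd, if_neg hd']
  refine ⟨u, h, ?_, ?_, ?_⟩
  · intro d
    rcases eq_or_ne d y with rfl | hdy
    · rw [huy, huαy]
    rcases eq_or_ne d (α y) with rfl | hdαy
    · rw [hα, huy, huαy, inv_inv]
    rw [hu d hdy hdαy, hu (α d) (fun e => hdαy (by rw [← e, hα])) (fun e => hdy (α.injective e))]
    by_cases hd : β d = d
    · rw [if_pos hd, if_pos (hβ.apply_eq_of_fixed hα hd)]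
      rcases hβ' d with e | e
      · rw [e, hβ'.apply_eq_of_fixed hα e]; simp
      · rw [hβ'.apply_apply_eq hα e, e]; simp
    · have e := (hβ d).resolve_left hd
      rw [if_neg hd, hβ.apply_apply_eq hα e, if_neg (hne d).symm, e]
      simp
  · intro d hdy
    rcases eq_or_ne d (α y) with rfl | hdαy
    · simp only [h]
      rw [huαy, hp, hq, hβαy, hβ'αy, hqαy, hpαy, show s (α y) = y from swap_apply_right _ _, hqy]
      simp
    rw [hu d hdy hdαy]
    by_cases hd : β d = d
    · rw [if_pos hd]
      simp only [h]
      rw [hp, hq, hd, hs d hdy hdαy]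
      group
    · have e := (hβ d).resolve_left hd
      rw [if_neg hd, mul_inv_cancel_left, e]
      simp only [h]
      rw [hp, hq, e, hext d e, hs _ (fun e => hdαy (by rw [← e, hα]))
        (fun e => hdy (α.injective e))]
  -- At `y` the two sides are `a` and `b⁻¹ * a * b`.
  · simp only [h]
    rw [huy, hp, hq, hy, hβy, show s y = α y from swap_apply_left _ _, hqαy, hpy, hqy, one_mul,
      mul_assoc]
    intro e
    exact hab (by rw [eq_inv_mul_iff_mul_eq] at e; exact e.symm)

end Equiv.Perm

/-! ### Cochains on surfaces of positive genus -/

namespace SurfaceMap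

variable {S : SurfaceMap.{u}}

theorem head_rev (d : S.Dart) : head (S.rev d) = tail d := by
  rw [head, S.rev_rev]

theorem tail_next (d : S.Dart) : tail (S.next d) = head d := by
  refine (Quotient.sound ?_ : tail (S.rev d) = tail (S.next d)).symm
  have := Equiv.Perm.sameCycle_apply_self S.rot (S.rev d)
  rwa [rot, Equiv.Perm.mul_apply, S.rev_rev] at this

theorem face_next (d : S.Dart) : face (S.next d) = face d :=
  (Quotient.sound (Equiv.Perm.sameCycle_apply_self S.next d) : face d = face (S.next d)).symm

theorem edge_eq_iff {d d' : S.Dart} : edge d = edge d' ↔ d' = d ∨ d' = S.rev d := by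
  constructor
  · intro h
    have h' : S.rev.SameCycle d d' := Quotient.exact h
    have hp : ∀ x, (fun x => x = d ∨ x = S.rev d) (S.rev x) = (fun x => x = d ∨ x = S.rev d) x := by
      intro x
      refine propext ⟨?_, ?_⟩
      · rintro (h | h)
        · exact Or.inr (by rw [← h, S.rev_rev])
        · exact Or.inl (S.rev.injective h)
      · rintro (rfl | rfl)
        · exact Or.inr rfl
        · exact Or.inl (S.rev_rev d)
    exact (h'.eq_of_invariant (p := fun x => x = d ∨ x = S.rev d) hp).mp (Or.inl rfl)
  · rintro (rfl | rfl)
    · rfl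
    · exact Quotient.sound (Equiv.Perm.sameCycle_apply_self S.rev d)

theorem two_mul_card_edge_le (S : SurfaceMap.{u}) : 2 * Nat.card S.Edge ≤ Nat.card S.Dart := by
  have := S.fintypeDart
  let out : S.Edge → S.Dart := Quotient.out
  have hout : ∀ e, edge (out e) = e := Quotient.out_eq
  have hinj : Function.Injective fun x : S.Edge × Bool => if x.2 then out x.1 else S.rev (out x.1) := by
    rintro ⟨e, i⟩ ⟨e', i'⟩ h
    have he : e = e' := by
      have hx : ∀ (e : S.Edge) (i : Bool), edge (if i then out e else S.rev (out e)) = e := by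
        intro e i
        cases i
        · exact (edge_eq_iff.2 (Or.inr (by simp [S.rev_rev]))).trans (hout e)
        · exact hout e
      rw [← hx e i, ← hx e' i']
      exact congrArg edge h
    subst he
    cases i <;> cases i' <;> simp [S.rev_ne, (S.rev_ne _).symm] at h ⊢
  have h := Nat.card_le_card_of_injective _ hinj
  rwa [Nat.card_prod, Nat.card_eq_fintype_card (α := Bool), Fintype.card_bool, mul_comm] at h

/-- On a surface of positive genus, noncommuting elements of a group give a cochain whose holonomy
round a single face is nontrivial. -/
theorem exists_cochain (hS : S.eulerChar ≤ 0) {G : Type*} [Group G] {a b : G}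
    (hab : a * b ≠ b * a) :
    ∃ (u h : S.Dart → G) (y : S.Dart), (∀ d, u (S.rev d) = (u d)⁻¹) ∧
      (∀ d, d ≠ y → h (S.next d) = h d * u d) ∧ h (S.next y) ≠ h y * u y := by
  classical
  have := S.fintypeDart
  have := S.nonemptyDart
  -- If split cycles are never reunited, the inequality together with `2 * E ≤ card Dart` and at
  -- least one cycle gives Euler characteristic at least 2.
  by_cases hsplit : ∀ β β' : Equiv.Perm S.Dart, β.IsPartOf S.rev → β'.IsPartOf S.rev →
      Equiv.Perm.Extends S.rev β β' →
      ∀ y, β' y = y → (S.next * β).SameCycle y (S.rev y) → (S.next * β').SameCycle y (S.rev y)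
  · obtain ⟨β, h⟩ := Equiv.Perm.card_add_two_mul_numCycles_le S.next S.rev S.rev_rev S.rev_ne hsplit
    have h1 := two_mul_card_edge_le S
    have h2 := Equiv.Perm.numCycles_pos (S.next * β)
    have hV : Nat.card S.Vertex = Equiv.Perm.numCycles (S.next * S.rev) := rfl
    have hF : Nat.card S.Face = Equiv.Perm.numCycles S.next := rfl
    rw [Nat.card_eq_fintype_card (α := S.Dart)] at h1
    rw [eulerChar] at hS
    omega
  · push Not at hsplit
    obtain ⟨β, β', hβ, hβ', hext, y, hy, h1, h2⟩ := hsplit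
    obtain ⟨u, h, hu⟩ := Equiv.Perm.exists_cochain hab S.next S.rev S.rev_rev S.rev_ne hβ hβ' hext
      hy h1 h2
    exact ⟨u, h, y, hu⟩

end SurfaceMap

/-! ### Holonomy round tiles -/

namespace Tiling

open SurfaceMap

variable {T : Tiling.{u}}

theorem exists_tail_mem_black (f : T.Face) : ∃ d : T.Dart, face d = f ∧ tail d ∈ T.black := by
  obtain ⟨d, rfl⟩ : ∃ d : T.Dart, face d = f := Quotient.exists_rep f
  by_cases h : tail d ∈ T.black
  · exact ⟨d, rfl, h⟩
  · exact ⟨T.next d, face_next d, by rwa [tail_next, T.bipartite]⟩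

theorem tail_next_mem_black (d : T.Dart) : tail (T.next d) ∈ T.black ↔ tail d ∉ T.black := by
  rw [tail_next, T.bipartite]

theorem tail_injective (d : T.Dart) {i j : Fin 4} (hij : i ≠ j) :
    ![tail d, tail (T.next d), tail (T.next (T.next d)), tail (T.next (T.next (T.next d)))] i ≠
    ![tail d, tail (T.next d), tail (T.next (T.next d)), tail (T.next (T.next (T.next d)))] j :=
  fun h => hij (T.embedded d h)

theorem face_eq_iff {d d' : T.Dart} : face d' = face d ↔
    d' = d ∨ d' = T.next d ∨ d' = T.next (T.next d) ∨ d' = T.next (T.next (T.next d)) := by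
  constructor
  · intro h
    have h' : T.next.SameCycle d d' := Quotient.exact h.symm
    have hp : ∀ x, (fun x => x = d ∨ x = T.next d ∨ x = T.next (T.next d) ∨
          x = T.next (T.next (T.next d))) (T.next x) =
        (fun x => x = d ∨ x = T.next d ∨ x = T.next (T.next d) ∨
          x = T.next (T.next (T.next d))) x := by
      intro x
      refine propext ⟨?_, ?_⟩
      · rintro (h | h | h | h)
        · refine Or.inr (Or.inr (Or.inr (T.next.injective ?_)))
          rw [h, T.next_four]
        · exact Or.inl (T.next.injective h)
        · exact Or.inr (Or.inl (T.next.injective h))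
        · exact Or.inr (Or.inr (Or.inl (T.next.injective h)))
      · rintro (rfl | rfl | rfl | rfl) <;> simp [T.next_four]
    exact (h'.eq_of_invariant (p := fun x => x = d ∨ x = T.next d ∨ x = T.next (T.next d) ∨
      x = T.next (T.next (T.next d))) hp).mp (Or.inl rfl)
  · rintro (rfl | rfl | rfl | rfl) <;> simp only [face_next]

theorem isCorner_face_iff {d : T.Dart} {x : T.Vertex} : IsCorner (face d) x ↔
    x = tail d ∨ x = tail (T.next d) ∨ x = tail (T.next (T.next d)) ∨
      x = tail (T.next (T.next (T.next d))) := by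
  constructor
  · rintro ⟨d', h, rfl⟩
    rcases face_eq_iff.1 h with rfl | rfl | rfl | rfl <;> simp
  · rintro (rfl | rfl | rfl | rfl) <;> exact ⟨_, by simp only [face_next], rfl⟩

/-- The holonomy of a cochain round the tile on the left of `d`, starting at `d`. -/
def holonomy {G : Type*} [Group G] (u : T.Dart → G) (d : T.Dart) : G :=
  u d * u (T.next d) * u (T.next (T.next d)) * u (T.next (T.next (T.next d)))

/-- Moving the starting corner conjugates the holonomy. -/
theorem holonomy_next_eq_one_iff {G : Type*} [Group G] (u : T.Dart → G) (d : T.Dart) :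
    holonomy u (T.next d) = 1 ↔ holonomy u d = 1 := by
  have e : holonomy u (T.next d) = (u d)⁻¹ * holonomy u d * u d := by
    simp only [holonomy, T.next_four]
    group
  rw [e, mul_assoc, inv_mul_eq_one, right_eq_mul]

theorem holonomy_eq_one_of_comm {G : Type*} [CommGroup G] {u : T.Dart → G}
    (hu : ∀ d, u (T.rev d) = (u d)⁻¹) {d₀ : T.Dart}
    (h : ∀ f, f ≠ face d₀ → ∃ d, face d = f ∧ holonomy u d = 1) : holonomy u d₀ = 1 := by
  classical
  have := T.fintypeDart
  have : Finite T.Face := Quotient.finite _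
  have := Fintype.ofFinite T.Face
  have hall : ∏ d, u d = 1 :=
    Finset.prod_involution (fun d _ => T.rev d) (fun d _ => by simp [hu])
      (fun d _ _ => T.rev_ne d) (fun d _ => Finset.mem_univ _) (fun d _ => T.rev_rev d)
  have hface : ∀ d : T.Dart, ∏ d' with face d' = face d, u d' = holonomy u d := by
    intro d
    have hne : ∀ i j : Fin 4, i ≠ j → ![d, T.next d, T.next (T.next d),
        T.next (T.next (T.next d))] i ≠ ![d, T.next d, T.next (T.next d),
        T.next (T.next (T.next d))] j := by
      intro i j hij e
      refine tail_injective d hij ?_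
      have := congrArg tail e
      fin_cases i <;> fin_cases j <;> exact this
    have hset : (Finset.univ.filter fun d' : T.Dart => face d' = face d) =
        {d, T.next d, T.next (T.next d), T.next (T.next (T.next d))} := by
      ext d'
      simp [face_eq_iff]
    have h01 := hne 0 1 (by decide)
    have h02 := hne 0 2 (by decide)
    have h03 := hne 0 3 (by decide)
    have h12 := hne 1 2 (by decide)
    have h13 := hne 1 3 (by decide)
    have h23 := hne 2 3 (by decide)
    simp only [Matrix.cons_val] at h01 h02 h03 h12 h13 h23
    rw [hset, Finset.prod_insert (by simp only [Finset.mem_insert, Finset.mem_singleton]; tauto),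
      Finset.prod_insert (by simp only [Finset.mem_insert, Finset.mem_singleton]; tauto),
      Finset.prod_insert (by simpa using h23), Finset.prod_singleton, holonomy]
    simp only [mul_assoc]
  rw [← hface, ← hall, ← Finset.prod_fiberwise Finset.univ face u]
  refine (Finset.prod_eq_single (f := fun f => ∏ d with face d = f, u d) (face d₀) ?_ ?_).symm
  · intro f _ hf
    obtain ⟨d, rfl, hd⟩ := h f hf
    exact (hface d).trans hd
  · exact fun h => absurd (Finset.mem_univ _) h

/-- The relations telescope round any tile not containing the dart `y`. On the tile of `y` the other
three sides satisfy them, so trivial holonomy would force the relation at `y` as well. -/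
theorem holonomy_of_potential {G : Type*} [Group G] {u h : T.Dart → G} {y : T.Dart}
    (hu : ∀ d, d ≠ y → h (T.next d) = h d * u d) (hy : h (T.next y) ≠ h y * u y) (d : T.Dart) :
    holonomy u d = 1 ↔ face d ≠ face y := by
  constructor
  · intro hd e
    have hd' : holonomy u y = 1 := by
      rcases face_eq_iff.1 e.symm with rfl | rfl | rfl | rfl <;>
        simpa only [holonomy_next_eq_one_iff] using hd
    have hne : ∀ i : Fin 4, i ≠ 0 → tail (![y, T.next y, T.next (T.next y),
        T.next (T.next (T.next y))] i) ≠ tail y := by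
      intro i hi
      have := tail_injective y hi
      fin_cases i <;> exact this
    have h1 := hu (T.next y) fun e => hne 1 (by decide) (congrArg tail e)
    have h2 := hu (T.next (T.next y)) fun e => hne 2 (by decide) (congrArg tail e)
    have h3 := hu (T.next (T.next (T.next y))) fun e => hne 3 (by decide) (congrArg tail e)
    rw [T.next_four, h2, h1] at h3
    refine hy ?_
    rw [holonomy, mul_assoc, mul_assoc, mul_eq_one_iff_eq_inv] at hd'
    rw [hd', h3]
    group
  · intro hf
    have h0 := hu d fun e => hf (e ▸ rfl)
    have h1 := hu (T.next d) fun e => hf (by rw [← e, face_next])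
    have h2 := hu (T.next (T.next d)) fun e => hf (by rw [← e, face_next, face_next])
    have h3 := hu (T.next (T.next (T.next d))) fun e => hf (by simp only [← e, face_next])
    rw [T.next_four, h2, h1, h0] at h3
    refine mul_left_cancel (a := h d) ?_
    rw [holonomy, mul_one, ← mul_assoc, ← mul_assoc, ← mul_assoc]
    exact h3.symm

end Tiling

/-! ### Points, hyperplanes and coherence in coordinates -/

namespace RingProj

open LinearMap

variable {R : Type v} [Ring R] {M : Type w} [AddCommGroup M] [Module R M]

theorem isCompl_span_ker {f : M →ₗ[R] R} {a : M} (h : IsUnit (f a)) :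
    IsCompl (Submodule.span R {a}) (ker f) := by
  obtain ⟨c, hc⟩ := h
  constructor
  · rw [Submodule.disjoint_def]
    intro x hx hxf
    obtain ⟨r, rfl⟩ := Submodule.mem_span_singleton.1 hx
    rw [mem_ker, map_smul, smul_eq_mul, ← hc] at hxf
    rw [(Units.mul_left_eq_zero c).1 hxf, zero_smul]
  · rw [codisjoint_iff, eq_top_iff]
    intro x _
    refine Submodule.mem_sup.2 ⟨(f x * ↑c⁻¹) • a,
      Submodule.smul_mem _ _ (Submodule.mem_span_singleton_self a),
      x - (f x * ↑c⁻¹) • a, ?_, by abel⟩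
    rw [mem_ker, map_sub, map_smul, smul_eq_mul, ← hc, mul_assoc, Units.inv_mul, mul_one, sub_self]

theorem isPoint_span {f : M →ₗ[R] R} {a : M} (h : IsUnit (f a)) :
    IsPoint (Submodule.span R {a}) := by
  refine ⟨⟨((LinearEquiv.ofInjective (toSpanSingleton R M a) ?_).trans
    (LinearEquiv.ofEq _ _ (LinearMap.range_toSpanSingleton a))).symm⟩, ker f,
    isCompl_span_ker h⟩
  rw [← ker_eq_bot, eq_bot_iff]
  intro r hr
  have hr' : r * f a = 0 := by
    rw [← smul_eq_mul, ← map_smul, ← toSpanSingleton_apply, mem_ker.1 hr, map_zero]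
  obtain ⟨c, hc⟩ := h
  rw [← hc] at hr'
  exact (Units.mul_left_eq_zero c).1 hr'

theorem isHyperplane_ker {f : M →ₗ[R] R} {a : M} (h : IsUnit (f a)) : IsHyperplane (ker f) :=
  ⟨_, isPoint_span h, isCompl_span_ker h⟩

theorem IsPoint.exists_eq_span {A : Submodule R M} (hA : IsPoint A) :
    ∃ a : M, A = Submodule.span R {a} ∧ ∀ r : R, r • a = 0 → r = 0 := by
  obtain ⟨⟨e⟩, -⟩ := hA
  refine ⟨e.symm 1, le_antisymm ?_ ?_, ?_⟩
  · intro x hx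
    refine Submodule.mem_span_singleton.2 ⟨e ⟨x, hx⟩, ?_⟩
    rw [← Submodule.coe_smul, ← map_smul, smul_eq_mul, mul_one, e.symm_apply_apply]
  · rw [Submodule.span_singleton_le_iff_mem]
    exact (e.symm 1).2
  · intro r hr
    rw [← Submodule.coe_smul, ← map_smul, smul_eq_mul, mul_one] at hr
    simpa using hr

theorem IsHyperplane.exists_eq_ker {l : Submodule R M} (hl : IsHyperplane l) :
    ∃ f : M →ₗ[R] R, l = ker f ∧ Function.Surjective f := by
  obtain ⟨A, ⟨⟨e⟩, -⟩, hAl⟩ := hl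
  refine ⟨e.toLinearMap ∘ₗ Submodule.projectionOnto A l hAl, ?_, ?_⟩
  · rw [LinearEquiv.ker_comp, Submodule.ker_projectionOnto]
  · exact e.surjective.comp (LinearMap.range_eq_top.1 (Submodule.range_projectionOnto hAl))

/-- Over a noncommutative ring both inverses are needed: spanning gives a left inverse `r` of `f a`,
and then `(f a * r - 1) • a` lies in both summands, so `r` is also a right inverse. -/
theorem isUnit_of_isCompl {f : M →ₗ[R] R} {a : M} (hf : Function.Surjective f)
    (ha : ∀ r : R, r • a = 0 → r = 0) (h : IsCompl (Submodule.span R {a}) (ker f)) :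
    IsUnit (f a) := by
  obtain ⟨v, hv⟩ := hf 1
  have hmem : v ∈ Submodule.span R {a} ⊔ ker f := h.sup_eq_top ▸ Submodule.mem_top
  obtain ⟨x, hx, k, hk, rfl⟩ := Submodule.mem_sup.1 hmem
  obtain ⟨r, rfl⟩ := Submodule.mem_span_singleton.1 hx
  have h1 : r * f a = 1 := by rwa [map_add, mem_ker.1 hk, add_zero, map_smul] at hv
  have h2 : f a * r = 1 := by
    refine sub_eq_zero.1 (ha _ ?_)
    refine Submodule.disjoint_def.1 h.disjoint _
      (Submodule.smul_mem _ _ (Submodule.mem_span_singleton_self a)) ?_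
    rw [mem_ker, map_smul, smul_eq_mul, sub_mul, mul_assoc, h1, mul_one, one_mul, sub_self]
  exact ⟨⟨f a, r, h2, h1⟩, rfl⟩

/-- With `t = c₁₁ * c₂₁⁻¹`, the vector `a₁ - t • a₂` lies in `ker f₁`, and it lies in `ker f₂` iff
`t * c₂₂ = c₁₂`. In that case each `fⱼ` sends `r • a₁ + s • a₂` to `r * t + s` times a unit, so the
kernels agree on the sum. -/
theorem coherent_iff {f₁ f₂ : M →ₗ[R] R} {a₁ a₂ : M} {c₁₁ c₁₂ c₂₁ c₂₂ : Rˣ}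
    (h₁₁ : f₁ a₁ = c₁₁) (h₁₂ : f₂ a₁ = c₁₂) (h₂₁ : f₁ a₂ = c₂₁) (h₂₂ : f₂ a₂ = c₂₂) :
    Coherent (Submodule.span R {a₁}) (Submodule.span R {a₂}) (ker f₁) (ker f₂) ↔
      c₁₁ * c₂₁⁻¹ * c₂₂ * c₁₂⁻¹ = 1 := by
  rw [mul_inv_eq_one]
  constructor
  · intro h
    have hx : a₁ - (↑(c₁₁ * c₂₁⁻¹) : R) • a₂ ∈
        (Submodule.span R {a₁} ⊔ Submodule.span R {a₂}) ⊓ ker f₁ := by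
      refine ⟨sub_mem (Submodule.mem_sup_left (Submodule.mem_span_singleton_self a₁))
        (Submodule.mem_sup_right
          (Submodule.smul_mem _ _ (Submodule.mem_span_singleton_self a₂))), ?_⟩
      change a₁ - (↑(c₁₁ * c₂₁⁻¹) : R) • a₂ ∈ ker f₁
      rw [mem_ker, map_sub, map_smul, h₁₁, h₂₁, smul_eq_mul, ← Units.val_mul,
        inv_mul_cancel_right, sub_self]
    rw [h] at hx
    have h2 := mem_ker.1 hx.2
    rw [map_sub, map_smul, h₁₂, h₂₂, smul_eq_mul, ← Units.val_mul, sub_eq_zero] at h2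
    exact (Units.ext h2).symm
  · intro h
    have hker : ∀ x ∈ Submodule.span R {a₁} ⊔ Submodule.span R {a₂}, x ∈ ker f₁ ↔ x ∈ ker f₂ := by
      intro x hx
      obtain ⟨y, hy, z, hz, rfl⟩ := Submodule.mem_sup.1 hx
      obtain ⟨r, rfl⟩ := Submodule.mem_span_singleton.1 hy
      obtain ⟨s, rfl⟩ := Submodule.mem_span_singleton.1 hz
      have e1 : f₁ (r • a₁ + s • a₂) = (r * ↑(c₁₁ * c₂₁⁻¹) + s) * c₂₁ := by
        rw [map_add, map_smul, map_smul, h₁₁, h₂₁, smul_eq_mul, smul_eq_mul, add_mul, mul_assoc,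
          ← Units.val_mul, inv_mul_cancel_right]
      have e2 : f₂ (r • a₁ + s • a₂) = (r * ↑(c₁₁ * c₂₁⁻¹) + s) * c₂₂ := by
        rw [map_add, map_smul, map_smul, h₁₂, h₂₂, smul_eq_mul, smul_eq_mul, add_mul, mul_assoc,
          ← Units.val_mul, h]
      rw [mem_ker, mem_ker, e1, e2, Units.mul_left_eq_zero, Units.mul_left_eq_zero]
    ext x
    exact and_congr_right fun hx => hker x hx

theorem Coherent.symm {A₁ A₂ l₁ l₂ : Submodule R M} (h : Coherent A₁ A₂ l₁ l₂) :
    Coherent A₁ A₂ l₂ l₁ := Eq.symm h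

theorem Coherent.swap {A₁ A₂ l₁ l₂ : Submodule R M} (h : Coherent A₁ A₂ l₁ l₂) :
    Coherent A₂ A₁ l₁ l₂ := by
  rw [Coherent, sup_comm]
  exact h

end RingProj

/-! ### Realizations and cochains -/

namespace Tiling

open SurfaceMap RingProj LinearMap

variable {T : Tiling.{u}} {R : Type v} [Ring R] {M : Type w} [AddCommGroup M] [Module R M]

/-- Homogeneous coordinates of a realization. -/
structure Realization.Coordinates (ρ : T.Realization R M) where
  vector : T.BlackVertex → M
  functional : T.WhiteVertex → M →ₗ[R] R
  cochain : T.Dart → Rˣ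
  point_eq : ∀ b, ρ.point b = Submodule.span R {vector b}
  hyperplane_eq : ∀ y, ρ.hyperplane y = ker (functional y)
  cochain_rev : ∀ d, cochain (T.rev d) = (cochain d)⁻¹
  functional_apply : ∀ (b : T.BlackVertex) (y : T.WhiteVertex) (d : T.Dart),
    tail d = b.1 → head d = y.1 → functional y (vector b) = cochain d

/-- Round a tile starting at a black corner, the sides alternately leave black and white vertices,
so the cochain contributes values and inverse values in exactly the order of `coherent_iff`.
Relabelling the two points or the two hyperplanes preserves coherence. -/
theorem Realization.Coordinates.tileCoherent_iff {ρ : T.Realization R M} (c : ρ.Coordinates)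
    {d : T.Dart} (hd : tail d ∈ T.black) :
    ρ.TileCoherent (face d) ↔ holonomy c.cochain d = 1 := by
  have hd1 : tail (T.next d) ∉ T.black := fun h => (tail_next_mem_black d).1 h hd
  have hd2 : tail (T.next (T.next d)) ∈ T.black := (tail_next_mem_black _).2 hd1
  have hd3 : tail (T.next (T.next (T.next d))) ∉ T.black :=
    fun h => (tail_next_mem_black _).1 h hd2
  let b₁ : T.BlackVertex := ⟨_, hd⟩
  let b₂ : T.BlackVertex := ⟨_, hd2⟩
  let y₁ : T.WhiteVertex := ⟨_, hd1⟩
  let y₂ : T.WhiteVertex := ⟨_, hd3⟩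
  have h12 : Coherent (ρ.point b₁) (ρ.point b₂) (ρ.hyperplane y₁) (ρ.hyperplane y₂) ↔
      holonomy c.cochain d = 1 := by
    rw [c.point_eq, c.point_eq, c.hyperplane_eq, c.hyperplane_eq,
      coherent_iff
        (c.functional_apply b₁ y₁ d rfl (tail_next d).symm)
        (c.functional_apply b₁ y₂ (T.rev (T.next (T.next (T.next d))))
          (by
            change head (T.next (T.next (T.next d))) = tail d
            rw [← tail_next, T.next_four])
          (head_rev _))
        (c.functional_apply b₂ y₁ (T.rev (T.next d)) (tail_next (T.next d)).symm (head_rev _))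
        (c.functional_apply b₂ y₂ (T.next (T.next d)) rfl (tail_next _).symm),
      c.cochain_rev, c.cochain_rev, inv_inv, inv_inv, holonomy]
  rw [← h12]
  constructor
  · intro h
    refine h b₁ b₂ y₁ y₂ ?_ ?_ ?_ ?_ ?_ ?_
    · exact fun e => tail_injective d (i := 0) (j := 2) (by decide) (congrArg Subtype.val e)
    · exact fun e => tail_injective d (i := 1) (j := 3) (by decide) (congrArg Subtype.val e)
    all_goals rw [isCorner_face_iff]; simp [b₁, b₂, y₁, y₂]
  · intro h b b' y y' hb hy hcb hcb' hcy hcy'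
    have hblack : ∀ b : T.BlackVertex, IsCorner (face d) b.1 → b = b₁ ∨ b = b₂ := by
      rintro ⟨x, hx⟩ hc
      rcases isCorner_face_iff.1 hc with h | h | h | h <;> dsimp only at h <;> subst h
      · exact Or.inl rfl
      · exact absurd hx hd1
      · exact Or.inr rfl
      · exact absurd hx hd3
    have hwhite : ∀ y : T.WhiteVertex, IsCorner (face d) y.1 → y = y₁ ∨ y = y₂ := by
      rintro ⟨x, hx⟩ hc
      rcases isCorner_face_iff.1 hc with h | h | h | h <;> dsimp only at h <;> subst h
      · exact absurd hd hx
      · exact Or.inl rfl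
      · exact absurd hd2 hx
      · exact Or.inr rfl
    rcases hblack b hcb with rfl | rfl <;> rcases hblack b' hcb' with rfl | rfl <;>
      rcases hwhite y hcy with rfl | rfl <;> rcases hwhite y' hcy' with rfl | rfl <;>
      first
      | exact absurd rfl hb
      | exact absurd rfl hy
      | exact h
      | exact h.symm
      | exact h.swap
      | exact h.symm.swap

theorem Realization.nonempty_coordinates (ρ : T.Realization R M) : Nonempty ρ.Coordinates := by
  classical
  choose a ha ha0 using fun b => (ρ.isPoint b).exists_eq_span
  choose f hf hfs using fun y => (ρ.isHyperplane y).exists_eq_ker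
  have hunit : ∀ b y, Adj b.1 y.1 → IsUnit (f y (a b)) := fun b y h =>
    isUnit_of_isCompl (hfs y) (ha0 b) (by
      have := ρ.nonNeighboring b y h
      rwa [ha, hf] at this)
  have hhead : ∀ d : T.Dart, tail d ∈ T.black → head d ∉ T.black :=
    fun d hd h => (T.bipartite d).1 h hd
  let v : (d : T.Dart) → tail d ∈ T.black → Rˣ := fun d hd =>
    (hunit ⟨tail d, hd⟩ ⟨head d, hhead d hd⟩ ⟨d, rfl⟩).unit
  have hrev : ∀ d : T.Dart, tail d ∉ T.black → tail (T.rev d) ∈ T.black :=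
    fun d hd => (T.bipartite d).2 hd
  let u : T.Dart → Rˣ := fun d =>
    if hd : tail d ∈ T.black then v d hd else (v (T.rev d) (hrev d hd))⁻¹
  have hu1 : ∀ d (hd : tail d ∈ T.black), u d = v d hd := fun d hd => dif_pos hd
  have hu2 : ∀ d (hd : tail d ∉ T.black), u d = (v (T.rev d) (hrev d hd))⁻¹ :=
    fun d hd => dif_neg hd
  refine ⟨⟨a, f, u, ha, hf, ?_, ?_⟩⟩
  · intro d
    by_cases hd : tail d ∈ T.black
    · have hd' : tail (T.rev d) ∉ T.black := hhead d hd
      rw [hu1 d hd, hu2 _ hd']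
      simp only [T.rev_rev]
    · rw [hu2 d hd, hu1 _ (hrev d hd), inv_inv]
  · rintro ⟨_, hb⟩ ⟨_, hy⟩ d rfl rfl
    rw [hu1 d hb]
    rfl

/-- Every cochain on a simple tiling comes from a realization in a space which has room for the
black vertices to be placed at distinct basis points. -/
theorem IsSimple.exists_realization (hT : T.IsSimple) {κ : Type*} [Fintype κ]
    (ι : T.BlackVertex ↪ κ) {u : T.Dart → Rˣ} (hu : ∀ d, u (T.rev d) = (u d)⁻¹) :
    ∃ (ρ : T.Realization R (κ → R)) (c : ρ.Coordinates), c.cochain = u := by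
  classical
  -- The value 0 for nonadjacent pairs is arbitrary; simplicity makes the chosen dart unique for
  -- adjacent ones.
  let m : T.BlackVertex → T.WhiteVertex → R := fun b y =>
    if h : ∃ d : T.Dart, tail d = b.1 ∧ head d = y.1 then u h.choose else 0
  have hm : ∀ (b : T.BlackVertex) (y : T.WhiteVertex) (d : T.Dart), tail d = b.1 →
      head d = y.1 → m b y = u d := by
    intro b y d hb hy
    have h : ∃ d : T.Dart, tail d = b.1 ∧ head d = y.1 := ⟨d, hb, hy⟩
    have hm' : m b y = u h.choose := dif_pos h
    obtain ⟨h1, h2⟩ := h.choose_spec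
    rw [hm']
    rcases edge_eq_iff.1 (hT d h.choose (by rw [hb, hy, h1, h2])) with e | e
    · rw [e]
    -- The reversed dart is excluded because its tail is white.
    · rw [e] at h1
      refine absurd (b.2 : b.1 ∈ T.black) ?_
      rw [← h1, show tail (T.rev d) = y.1 from hy]
      exact y.2
  let a : T.BlackVertex → κ → R := fun b => Pi.single (ι b) 1
  -- Since the points are distinct basis vectors, a functional may take any prescribed values on
  -- them; it is 0 on the unused basis vectors.
  let f : T.WhiteVertex → (κ → R) →ₗ[R] R := fun y =>
    Fintype.linearCombination R (Function.extend ι (fun b => m b y) 0)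
  have hf : ∀ b y, f y (a b) = m b y := by
    intro b y
    simp only [f, a]
    rw [Fintype.linearCombination_apply_single, ι.injective.extend_apply, one_smul]
  have hadj : ∀ (b : T.BlackVertex) (y : T.WhiteVertex), Adj b.1 y.1 → IsUnit (f y (a b)) := by
    rintro b y ⟨d, hd⟩
    rcases Sym2.eq_iff.1 hd with ⟨h1, h2⟩ | ⟨h1, h2⟩
    · rw [hf, hm b y d h1 h2]
      exact Units.isUnit _
    · rw [hf, hm b y (T.rev d) h2 (by rw [head_rev, h1])]
      exact Units.isUnit _
  -- Every vertex has an edge, so a unit value is available to certify each span as a point and each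
  -- kernel as a hyperplane.
  have hblack : ∀ b : T.BlackVertex, ∃ y : T.WhiteVertex, Adj b.1 y.1 := by
    rintro ⟨x, hx⟩
    obtain ⟨d, rfl⟩ : ∃ d : T.Dart, tail d = x := Quotient.exists_rep x
    exact ⟨⟨head d, fun h => (T.bipartite d).1 h hx⟩, d, rfl⟩
  have hwhite : ∀ y : T.WhiteVertex, ∃ b : T.BlackVertex, Adj b.1 y.1 := by
    rintro ⟨x, hx⟩
    obtain ⟨d, rfl⟩ : ∃ d : T.Dart, tail d = x := Quotient.exists_rep x
    exact ⟨⟨head d, (T.bipartite d).2 hx⟩, d, Sym2.eq_swap⟩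
  refine ⟨⟨fun b => Submodule.span R {a b}, fun y => ker (f y), ?_, ?_, ?_⟩,
    ⟨a, f, u, fun _ => rfl, fun _ => rfl, hu, ?_⟩, rfl⟩
  · intro b
    obtain ⟨y, h⟩ := hblack b
    exact isPoint_span (hadj b y h)
  · intro y
    obtain ⟨b, h⟩ := hwhite y
    exact isHyperplane_ker (hadj b y h)
  · exact fun b y h => isCompl_span_ker (hadj b y h)
  · intro b y d h1 h2
    rw [hf, hm b y d h1 h2]

theorem incidenceTheorem_of_comm (T : Tiling.{u}) (n : ℕ) (hR : ∀ a b : Rˣ, a * b = b * a) :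
    T.IncidenceTheorem n R := by
  intro ρ f₀ h
  obtain ⟨c⟩ := ρ.nonempty_coordinates
  obtain ⟨d₀, rfl, hd₀⟩ := exists_tail_mem_black f₀
  rw [c.tileCoherent_iff hd₀]
  let _ : CommGroup Rˣ := { (inferInstance : Group Rˣ) with mul_comm := hR }
  refine holonomy_eq_one_of_comm (G := Rˣ) c.cochain_rev fun f hf => ?_
  obtain ⟨d, rfl, hd⟩ := exists_tail_mem_black f
  exact ⟨d, rfl, (c.tileCoherent_iff hd).1 (h _ hf)⟩

theorem IsSimple.comm_of_incidenceTheorem (hT : T.IsSimple) (hχ : T.eulerChar ≤ 0) {n : ℕ}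
    (hn : Nat.card T.BlackVertex ≤ n + 1) (h : T.IncidenceTheorem n R) (a b : Rˣ) :
    a * b = b * a := by
  classical
  by_contra hab
  obtain ⟨u, p, y, hu, hp, hy⟩ := T.exists_cochain hχ hab
  have := T.fintypeDart
  have : Finite T.Vertex := Quotient.finite _
  have : Finite T.BlackVertex := Subtype.finite
  have := Fintype.ofFinite T.BlackVertex
  obtain ⟨ι⟩ : Nonempty (T.BlackVertex ↪ Fin (n + 1)) :=
    Function.Embedding.nonempty_of_card_le (by
      rwa [Fintype.card_fin, ← Nat.card_eq_fintype_card])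
  obtain ⟨ρ, c, rfl⟩ := hT.exists_realization (R := R) ι hu
  obtain ⟨d₀, hface, hd₀⟩ := exists_tail_mem_black (face y)
  -- In this realization exactly the tile containing `y` is incoherent.
  have key := h ρ (face d₀) fun f hf => by
    obtain ⟨d, rfl, hd⟩ := exists_tail_mem_black f
    rw [c.tileCoherent_iff hd, holonomy_of_potential hp hy, ← hface]
    exact hf
  rw [c.tileCoherent_iff hd₀, holonomy_of_potential hp hy] at key
  exact key hface

end Tiling

theorem mainTheorem4 (T : Tiling.{u}) (hsimple : T.IsSimple)
    (g : ℕ) (hg : 0 < g) (hgenus : T.HasGenus g)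
    (R : Type v) [Ring R] (n : ℕ) (hn : (Nat.card T.BlackVertex : ℤ) - 1 ≤ (n : ℤ)) :
    T.IncidenceTheorem n R ↔ ∀ a b : Rˣ, a * b = b * a := by
  have hχ : T.eulerChar ≤ 0 := by
    rw [SurfaceMap.HasGenus] at hgenus
    omega
  exact ⟨hsimple.comm_of_incidenceTheorem hχ (by omega), T.incidenceTheorem_of_comm n⟩
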